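/- Let $\mathbb{L}$ be a distributive lattice, let $\mathbb{L}^*$ be the set of lattice homomorphisms $x^*\colon\mathbb{L}\to[-1,1]$, and let $K$ be either $[-1,1]^{\mathbb{L}}$ (the set of all functions $\mathbb{L}\to[-1,1]$) or $\mathbb{L}^*$. For $f\colon K\to\mathbb{R}$ put $$\|f\|_K=\sup\Big\{\sum_{i=1}^n|f(x_i^*)| : n\in\mathbb{N},\ x_1^*,\dots,x_n^*\in K,\ \sum_{i=1}^n|x_i^*(x)|\le 1\text{ for all }x\in\mathbb{L}\Big\}.$$ The functions with $\|f\|_K<\infty$ form a Banach lattice under this norm, the pointwise order and the pointwise operations. Its smallest closed vector sublattice containing all the evaluations $\delta_x(x^*)=x^*(x)$, $x\in\mathbb{L}$, is denoted $FBL(\mathbb{L})$ if $K=[-1,1]^{\mathbb{L}}$ (the free Banach lattice generated by the set $\mathbb{L}$) and $FBL\langle\mathbb{L}\rangle$ if $K=\mathbb{L}^*$ (the free Banach lattice generated by the lattice $\mathbb{L}$). Let $R\colon FBL(\mathbb{L})\to FBL\langle\mathbb{L}\rangle$ be the restriction map $R(f)=f|_{\mathbb{L}^*}$. A Banach lattice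 homomorphism is a bounded linear operator between Banach lattices that preserves the lattice operations. A Banach lattice $P$ is called $\infty$-projective if there is a real number $\lambda>1$ such that, for every Banach lattice $X$, every closed ideal $J$ of $X$ with quotient map $Q\colon X\to X/J$, and every Banach lattice homomorphism $T\colon P\to X/J$, there is a Banach lattice homomorphism $\hat T\colon P\to X$ with $Q\circ\hat T=T$ and $\|\hat T\|\le\lambda\|T\|$. Then $FBL\langle\mathbb{L}\rangle$ is $\infty$-projective if and only if there exists a Banach lattice homomorphism $u\colon FBL\langle\mathbb{L}\rangle\to FBL(\mathbb{L})$ such that $R\circ u=\mathrm{id}_{FBL\langle\mathbb{L}\rangle}$. -/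

import Mathlib

universe u

/-- A (real) Banach lattice: a complete normed space with a lattice order that is compatible with
the vector space structure and for which the norm is a lattice norm
(`|x| ≤ |y|` implies `‖x‖ ≤ ‖y‖`). -/
class BanachLattice (X : Type*) [NormedAddCommGroup X] [NormedSpace ℝ X] [Lattice X] : Prop
    extends IsOrderedAddMonoid X, PosSMulMono ℝ X, HasSolidNorm X, CompleteSpace X

/-- A bounded linear operator is a Banach lattice homomorphism if it preserves the lattice
operations. -/
def IsBanachLatticeHom {X Y : Type*} [NormedAddCommGroup X] [NormedSpace ℝ X] [Lattice X]
    [NormedAddCommGroup Y] [NormedSpace ℝ Y] [Lattice Y] (T : X →L[ℝ] Y) : Prop :=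
  (∀ x y : X, T (x ⊔ y) = T x ⊔ T y) ∧ (∀ x y : X, T (x ⊓ y) = T x ⊓ T y)

/-! ### Quotients by closed ideals -/

/-- A closed ideal of a Banach lattice: a norm-closed, solid linear subspace. -/
structure ClosedIdeal (X : Type*) [NormedAddCommGroup X] [NormedSpace ℝ X] [Lattice X]
    extends Submodule ℝ X where
  solid' : LatticeOrderedAddCommGroup.IsSolid carrier
  closed' : IsClosed carrier

namespace ClosedIdeal

variable {X : Type*} [NormedAddCommGroup X] [NormedSpace ℝ X] [Lattice X]

/-- The quotient `X / J`, with its usual linear structure. -/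
def Quot (J : ClosedIdeal X) : Type _ := X ⧸ J.toSubmodule

variable (J : ClosedIdeal X)

instance isClosed : IsClosed (J.toSubmodule : Set X) := J.closed'

/-- The quotient norm `‖[x]‖ = inf {‖y‖ : x - y ∈ J}`. -/
noncomputable instance : NormedAddCommGroup J.Quot :=
  Submodule.Quotient.normedAddCommGroup J.toSubmodule

noncomputable instance : NormedSpace ℝ J.Quot :=
  Submodule.Quotient.normedSpace J.toSubmodule ℝ

/-- The quotient map as a linear map. -/
def mkₗ : X →ₗ[ℝ] J.Quot := J.toSubmodule.mkQ

theorem mkₗ_surjective (q : J.Quot) : ∃ x, J.mkₗ x = q :=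
  J.toSubmodule.mkQ_surjective q

theorem mkₗ_eq {x y : X} : J.mkₗ x = J.mkₗ y ↔ x - y ∈ J.toSubmodule :=
  Submodule.Quotient.eq J.toSubmodule

theorem norm_mkₗ_le (x : X) : ‖J.mkₗ x‖ ≤ ‖x‖ :=
  Submodule.Quotient.norm_mk_le J.toSubmodule x

theorem exists_norm_lt (q : J.Quot) {ε : ℝ} (hε : 0 < ε) :
    ∃ x, J.mkₗ x = q ∧ ‖x‖ < ‖q‖ + ε :=
  Submodule.Quotient.norm_mk_lt (S := J.toSubmodule) q hε

/-- The quotient map `X → X / J`. -/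
noncomputable def quotMap : X →L[ℝ] J.Quot :=
  J.mkₗ.mkContinuous 1 fun x => by simpa using J.norm_mkₗ_le x

theorem mem_of_abs_le {x y : X} (h : |y| ≤ |x|) (hx : x ∈ J.toSubmodule) : y ∈ J.toSubmodule :=
  J.solid' hx h

variable [BanachLattice X]

theorem abs_mem {x : X} (hx : x ∈ J.toSubmodule) : |x| ∈ J.toSubmodule :=
  J.mem_of_abs_le (abs_abs x).le hx

theorem mem_of_le_add {x y z : X} (hx : x ∈ J.toSubmodule) (hy : y ∈ J.toSubmodule)
    (h : |z| ≤ |x| + |y|) : z ∈ J.toSubmodule :=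
  J.mem_of_abs_le (h.trans (le_abs_self _)) (J.toSubmodule.add_mem (J.abs_mem hx) (J.abs_mem hy))

theorem sup_sub_sup_mem {a b c d : X} (h₁ : a - c ∈ J.toSubmodule) (h₂ : b - d ∈ J.toSubmodule) :
    a ⊔ b - c ⊔ d ∈ J.toSubmodule := by
  refine J.mem_of_le_add h₁ h₂ ?_
  calc |a ⊔ b - c ⊔ d| = |(a ⊔ b - c ⊔ b) + (c ⊔ b - c ⊔ d)| := by rw [sub_add_sub_cancel]
    _ ≤ |a ⊔ b - c ⊔ b| + |c ⊔ b - c ⊔ d| := abs_add_le _ _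
    _ ≤ |a - c| + |b - d| := by
      refine add_le_add (abs_sup_sub_sup_le_abs _ _ _) ?_
      rw [sup_comm c, sup_comm c]
      exact abs_sup_sub_sup_le_abs _ _ _

theorem inf_sub_inf_mem {a b c d : X} (h₁ : a - c ∈ J.toSubmodule) (h₂ : b - d ∈ J.toSubmodule) :
    a ⊓ b - c ⊓ d ∈ J.toSubmodule := by
  refine J.mem_of_le_add h₁ h₂ ?_
  calc |a ⊓ b - c ⊓ d| = |(a ⊓ b - c ⊓ b) + (c ⊓ b - c ⊓ d)| := by rw [sub_add_sub_cancel]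
    _ ≤ |a ⊓ b - c ⊓ b| + |c ⊓ b - c ⊓ d| := abs_add_le _ _
    _ ≤ |a - c| + |b - d| := by
      refine add_le_add (abs_inf_sub_inf_le_abs _ _ _) ?_
      rw [inf_comm c, inf_comm c]
      exact abs_inf_sub_inf_le_abs _ _ _

/-- `[x] ⊔ [y] = [x ⊔ y]`. -/
def quotSup : J.Quot → J.Quot → J.Quot :=
  Quotient.map₂ (· ⊔ ·) fun _ _ h₁ _ _ h₂ =>
    (Submodule.quotientRel_def _).2 (J.sup_sub_sup_mem
      ((Submodule.quotientRel_def _).1 h₁) ((Submodule.quotientRel_def _).1 h₂))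

/-- `[x] ⊓ [y] = [x ⊓ y]`. -/
def quotInf : J.Quot → J.Quot → J.Quot :=
  Quotient.map₂ (· ⊓ ·) fun _ _ h₁ _ _ h₂ =>
    (Submodule.quotientRel_def _).2 (J.inf_sub_inf_mem
      ((Submodule.quotientRel_def _).1 h₁) ((Submodule.quotientRel_def _).1 h₂))

/-- The quotient order: `[x] ≤ [y]` iff `[x ⊔ y] = [y]`, so that the quotient map is a lattice
homomorphism. -/
noncomputable instance : Lattice J.Quot :=
  @Lattice.mk' J.Quot ⟨J.quotSup⟩ ⟨J.quotInf⟩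
    (fun a b => by
      obtain ⟨x, rfl⟩ := J.mkₗ_surjective a
      obtain ⟨y, rfl⟩ := J.mkₗ_surjective b
      exact congrArg J.mkₗ (sup_comm x y))
    (fun a b c => by
      obtain ⟨x, rfl⟩ := J.mkₗ_surjective a
      obtain ⟨y, rfl⟩ := J.mkₗ_surjective b
      obtain ⟨z, rfl⟩ := J.mkₗ_surjective c
      exact congrArg J.mkₗ (sup_assoc x y z))
    (fun a b => by
      obtain ⟨x, rfl⟩ := J.mkₗ_surjective a
      obtain ⟨y, rfl⟩ := J.mkₗ_surjective b
      exact congrArg J.mkₗ (inf_comm x y))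
    (fun a b c => by
      obtain ⟨x, rfl⟩ := J.mkₗ_surjective a
      obtain ⟨y, rfl⟩ := J.mkₗ_surjective b
      obtain ⟨z, rfl⟩ := J.mkₗ_surjective c
      exact congrArg J.mkₗ (inf_assoc x y z))
    (fun a b => by
      obtain ⟨x, rfl⟩ := J.mkₗ_surjective a
      obtain ⟨y, rfl⟩ := J.mkₗ_surjective b
      exact congrArg J.mkₗ sup_inf_self)
    (fun a b => by
      obtain ⟨x, rfl⟩ := J.mkₗ_surjective a
      obtain ⟨y, rfl⟩ := J.mkₗ_surjective b
      exact congrArg J.mkₗ inf_sup_self)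

theorem mkₗ_sup (x y : X) : J.mkₗ (x ⊔ y) = J.mkₗ x ⊔ J.mkₗ y := rfl

theorem mkₗ_inf (x y : X) : J.mkₗ (x ⊓ y) = J.mkₗ x ⊓ J.mkₗ y := rfl

theorem mkₗ_abs (x : X) : J.mkₗ |x| = |J.mkₗ x| := by
  rw [abs, abs, mkₗ_sup, map_neg]

theorem mkₗ_mono {x y : X} (h : x ≤ y) : J.mkₗ x ≤ J.mkₗ y := by
  rw [← sup_eq_right, ← mkₗ_sup, sup_eq_right.2 h]

theorem exists_le_of_le {a b : J.Quot} (h : a ≤ b) :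
    ∃ x y : X, x ≤ y ∧ J.mkₗ x = a ∧ J.mkₗ y = b := by
  obtain ⟨x, rfl⟩ := J.mkₗ_surjective a
  obtain ⟨y, rfl⟩ := J.mkₗ_surjective b
  exact ⟨x, x ⊔ y, le_sup_left, rfl, by rw [mkₗ_sup, sup_eq_right.2 h]⟩

instance : IsOrderedAddMonoid J.Quot where
  add_le_add_left a b h c := by
    obtain ⟨x, y, hxy, rfl, rfl⟩ := J.exists_le_of_le h
    obtain ⟨z, rfl⟩ := J.mkₗ_surjective c
    rw [← map_add, ← map_add]
    exact J.mkₗ_mono (by gcongr)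

instance : PosSMulMono ℝ J.Quot where
  smul_le_smul_of_nonneg_left r hr a b h := by
    obtain ⟨x, y, hxy, rfl, rfl⟩ := J.exists_le_of_le h
    rw [← map_smul, ← map_smul]
    exact J.mkₗ_mono (smul_le_smul_of_nonneg_left hxy hr)

instance : HasSolidNorm J.Quot where
  solid a b h := by
    refine le_of_forall_pos_le_add fun ε hε => ?_
    obtain ⟨y, rfl, hy⟩ := J.exists_norm_lt b hε
    obtain ⟨x, rfl⟩ := J.mkₗ_surjective a
    have h1 : J.mkₗ ((x ⊓ |y|) ⊔ -|y|) = J.mkₗ x := by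
      rw [mkₗ_sup, mkₗ_inf, map_neg, mkₗ_abs, inf_eq_left.2 ((le_abs_self _).trans h),
        sup_eq_left.2 (neg_le.1 ((neg_le_abs _).trans h))]
    have h2 : abs ((x ⊓ |y|) ⊔ -|y|) ≤ |y| := by
      refine abs_le'.2 ⟨sup_le inf_le_right ?_, neg_le.1 le_sup_right⟩
      exact (neg_nonpos.2 (abs_nonneg y)).trans (abs_nonneg y)
    calc ‖J.mkₗ x‖ = ‖J.mkₗ ((x ⊓ |y|) ⊔ -|y|)‖ := by rw [h1]
      _ ≤ ‖(x ⊓ |y|) ⊔ -|y|‖ := J.norm_mkₗ_le _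
      _ ≤ ‖y‖ := HasSolidNorm.solid h2
      _ ≤ _ := hy.le

instance : CompleteSpace J.Quot :=
  Submodule.Quotient.completeSpace J.toSubmodule

instance : BanachLattice J.Quot where

end ClosedIdeal

/-! ### Projectivity -/

/-- `P` is `lam`-projective: every Banach lattice homomorphism `T : P → X / J` into a quotient of
a Banach lattice `X` by a closed ideal `J` lifts to a Banach lattice homomorphism `S : P → X`
with `‖S‖ ≤ lam * ‖T‖`. -/
def IsLambdaProjective (lam : ℝ) (P : Type u) [NormedAddCommGroup P] [NormedSpace ℝ P]
    [Lattice P] [BanachLattice P] : Prop :=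
  ∀ (X : Type u) [NormedAddCommGroup X] [NormedSpace ℝ X] [Lattice X] [BanachLattice X]
    (J : ClosedIdeal X) (T : P →L[ℝ] J.Quot), IsBanachLatticeHom T →
      ∃ S : P →L[ℝ] X, IsBanachLatticeHom S ∧ J.quotMap.comp S = T ∧ ‖S‖ ≤ lam * ‖T‖

/-- `P` is `∞`-projective: it is `lam`-projective for some real `lam > 1`. -/
def IsInftyProjective (P : Type u) [NormedAddCommGroup P] [NormedSpace ℝ P]
    [Lattice P] [BanachLattice P] : Prop :=
  ∃ lam : ℝ, 1 < lam ∧ IsLambdaProjective lam P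

/-! ### Free Banach lattices

Both `FBL(A)` and `FBL⟨𝕃⟩` are spaces of functions on a set `K ⊆ [-1,1]^A`, with the same formula
for the norm: `K = [-1,1]^A` for the former, and `A = 𝕃`, `K = 𝕃*` for the latter. -/

namespace FBL

variable {A : Type*} (K : Set (A → Set.Icc (-1 : ℝ) 1))

/-- Finite families `x₁, …, xₙ` in `K` with `sup_a ∑ᵢ |xᵢ(a)| ≤ 1`. -/
def Family : Type _ :=
  {p : Σ n : ℕ, Fin n → K // ∀ a : A, ∑ i, |(((p.2 i : A → Set.Icc (-1 : ℝ) 1) a : ℝ))| ≤ 1}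

variable {K}

/-- The sum `∑ᵢ |f(xᵢ)|`. -/
def famSum (f : K → ℝ) (p : Family K) : ℝ := ∑ i, |f (p.1.2 i)|

/-- The empty family. -/
instance : Nonempty (Family K) := ⟨⟨⟨0, Fin.elim0⟩, fun a => by simp⟩⟩

/-- The family consisting of one point. -/
def single (x : K) : Family K :=
  ⟨⟨1, fun _ => x⟩, fun a => by
    simpa using abs_le.2 ⟨((x : A → Set.Icc (-1 : ℝ) 1) a).2.1,
      ((x : A → Set.Icc (-1 : ℝ) 1) a).2.2⟩⟩

theorem famSum_single (f : K → ℝ) (x : K) : famSum f (single x) = |f x| := by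
  exact Fin.sum_univ_one fun _ => |f x|

theorem famSum_nonneg (f : K → ℝ) (p : Family K) : 0 ≤ famSum f p :=
  Finset.sum_nonneg fun _ _ => abs_nonneg _

theorem famSum_mono {f g : K → ℝ} (h : ∀ x, |f x| ≤ |g x|) (p : Family K) :
    famSum f p ≤ famSum g p :=
  Finset.sum_le_sum fun _ _ => h _

theorem famSum_add_le (f g : K → ℝ) (p : Family K) :
    famSum (f + g) p ≤ famSum f p + famSum g p := by
  rw [famSum, famSum, famSum, ← Finset.sum_add_distrib]
  exact Finset.sum_le_sum fun _ _ => abs_add_le _ _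

theorem famSum_smul (c : ℝ) (f : K → ℝ) (p : Family K) :
    famSum (c • f) p = |c| * famSum f p := by
  simp [famSum, abs_mul, Finset.mul_sum]

variable (K)

/-- The functions `f : K → ℝ` with `‖f‖ < ∞`, i.e. for which the sums defining the norm are
bounded. -/
def finiteNorm : Submodule ℝ (K → ℝ) where
  carrier := {f | BddAbove (Set.range (famSum f))}
  zero_mem' := ⟨0, by rintro _ ⟨p, rfl⟩; simp [famSum]⟩
  add_mem' := by
    rintro f g ⟨a, ha⟩ ⟨b, hb⟩
    refine ⟨a + b, ?_⟩
    rintro _ ⟨p, rfl⟩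
    exact (famSum_add_le f g p).trans (add_le_add (ha ⟨p, rfl⟩) (hb ⟨p, rfl⟩))
  smul_mem' := by
    rintro c f ⟨a, ha⟩
    refine ⟨|c| * a, ?_⟩
    rintro _ ⟨p, rfl⟩
    rw [famSum_smul]
    exact mul_le_mul_of_nonneg_left (ha ⟨p, rfl⟩) (abs_nonneg c)

variable {K} in
theorem mem_finiteNorm_of_abs_le {f g : K → ℝ} (hg : g ∈ finiteNorm K) (h : ∀ x, |f x| ≤ |g x|) :
    f ∈ finiteNorm K := by
  obtain ⟨a, ha⟩ := hg
  exact ⟨a, by rintro _ ⟨p, rfl⟩; exact (famSum_mono h p).trans (ha ⟨p, rfl⟩)⟩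

variable {K} in
theorem abs_mem_finiteNorm {f : K → ℝ} (hf : f ∈ finiteNorm K) : |f| ∈ finiteNorm K :=
  mem_finiteNorm_of_abs_le hf fun x => by simp

variable {K} in
theorem sup_mem_finiteNorm {f g : K → ℝ} (hf : f ∈ finiteNorm K) (hg : g ∈ finiteNorm K) :
    f ⊔ g ∈ finiteNorm K := by
  refine mem_finiteNorm_of_abs_le
    ((finiteNorm K).add_mem (abs_mem_finiteNorm hf) (abs_mem_finiteNorm hg)) fun x => ?_
  refine le_trans ?_ (le_abs_self _)
  simp only [Pi.sup_apply, Pi.add_apply, Pi.abs_apply]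
  rcases le_total (f x) (g x) with h | h
  · rw [sup_eq_right.2 h]; linarith [abs_nonneg (f x)]
  · rw [sup_eq_left.2 h]; linarith [abs_nonneg (g x)]

variable {K} in
theorem inf_mem_finiteNorm {f g : K → ℝ} (hf : f ∈ finiteNorm K) (hg : g ∈ finiteNorm K) :
    f ⊓ g ∈ finiteNorm K := by
  have h := (finiteNorm K).neg_mem (sup_mem_finiteNorm ((finiteNorm K).neg_mem hf)
    ((finiteNorm K).neg_mem hg))
  rwa [neg_sup, neg_neg, neg_neg] at h

/-- The Banach lattice of all functions `f : K → ℝ` of finite norm, with the pointwise order and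
pointwise operations. -/
def Ambient : Type _ := finiteNorm K

namespace Ambient

noncomputable instance : AddCommGroup (Ambient K) := inferInstanceAs (AddCommGroup (finiteNorm K))

noncomputable instance : Module ℝ (Ambient K) := inferInstanceAs (Module ℝ (finiteNorm K))

noncomputable instance : Lattice (Ambient K) :=
  Subtype.lattice (P := fun f : K → ℝ => f ∈ finiteNorm K)
    (fun _ _ hf hg => sup_mem_finiteNorm hf hg) (fun _ _ hf hg => inf_mem_finiteNorm hf hg)

variable {K}

instance : CoeFun (Ambient K) (fun _ => K → ℝ) := ⟨fun f => f.1⟩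

@[ext] theorem ext {f g : Ambient K} (h : ∀ x, f x = g x) : f = g := Subtype.ext (funext h)

theorem add_apply (f g : Ambient K) (x : K) : (f + g) x = f x + g x := rfl
theorem sub_apply (f g : Ambient K) (x : K) : (f - g) x = f x - g x := rfl
theorem neg_apply (f : Ambient K) (x : K) : (-f) x = -f x := rfl
theorem zero_apply (x : K) : (0 : Ambient K) x = 0 := rfl
theorem smul_apply (c : ℝ) (f : Ambient K) (x : K) : (c • f) x = c * f x := rfl
theorem sup_apply (f g : Ambient K) (x : K) : (f ⊔ g) x = f x ⊔ g x := rfl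
theorem inf_apply (f g : Ambient K) (x : K) : (f ⊓ g) x = f x ⊓ g x := rfl
theorem abs_apply (f : Ambient K) (x : K) : |f| x = |f x| := rfl
theorem le_def {f g : Ambient K} : f ≤ g ↔ ∀ x, f x ≤ g x := Iff.rfl

/-- The norm
`‖f‖ = sup {∑ᵢ |f(xᵢ)| : n ∈ ℕ, x₁, …, xₙ ∈ K, sup_a ∑ᵢ |xᵢ(a)| ≤ 1}`. -/
noncomputable instance : Norm (Ambient K) := ⟨fun f => ⨆ p : Family K, famSum f p⟩

theorem norm_def (f : Ambient K) : ‖f‖ = ⨆ p : Family K, famSum f p := rfl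

theorem famSum_le_norm (f : Ambient K) (p : Family K) : famSum f p ≤ ‖f‖ :=
  le_ciSup (f := fun p => famSum f p) f.2 p

theorem norm_le_of {f : Ambient K} {C : ℝ} (h : ∀ p : Family K, famSum f p ≤ C) : ‖f‖ ≤ C :=
  ciSup_le h

theorem abs_apply_le_norm (f : Ambient K) (x : K) : |f x| ≤ ‖f‖ := by
  rw [← famSum_single]; exact famSum_le_norm f _

theorem core : NormedSpace.Core ℝ (Ambient K) where
  norm_nonneg f := (famSum_nonneg f _).trans (famSum_le_norm f (Classical.arbitrary _))
  norm_smul c f := by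
    have h : ∀ p, famSum (c • f : Ambient K) p = |c| * famSum f p := famSum_smul c f
    rw [norm_def, norm_def, Real.norm_eq_abs, Real.mul_iSup_of_nonneg (abs_nonneg c)]
    simp_rw [h]
  norm_triangle f g := norm_le_of fun p =>
    (famSum_add_le f g p).trans (add_le_add (famSum_le_norm f p) (famSum_le_norm g p))
  norm_eq_zero_iff f := by
    constructor
    · intro h
      ext x
      have := abs_apply_le_norm f x
      rw [h] at this
      exact abs_nonpos_iff.1 this
    · rintro rfl
      have h : ∀ p, famSum (0 : Ambient K) p = 0 := fun p => by
        simp [famSum, zero_apply]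
      rw [norm_def]
      simp_rw [h]
      simp

noncomputable instance : NormedAddCommGroup (Ambient K) := NormedAddCommGroup.ofCore core

noncomputable instance : NormedSpace ℝ (Ambient K) := NormedSpace.ofCore core

instance : IsOrderedAddMonoid (Ambient K) where
  add_le_add_left _ _ h c x := by
    simpa [add_apply] using h x

instance : PosSMulMono ℝ (Ambient K) where
  smul_le_smul_of_nonneg_left _ hr _ _ h x := mul_le_mul_of_nonneg_left (h x) hr

instance : HasSolidNorm (Ambient K) where
  solid _ g h := norm_le_of fun p => (famSum_mono h p).trans (famSum_le_norm g p)

instance : CompleteSpace (Ambient K) := by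
  refine Metric.complete_of_cauchySeq_tendsto fun u hu => ?_
  have hpt : ∀ x : K, CauchySeq fun n => u n x := by
    intro x
    rw [Metric.cauchySeq_iff'] at hu ⊢
    intro ε hε
    obtain ⟨N, hN⟩ := hu ε hε
    refine ⟨N, fun n hn => ?_⟩
    have h := hN n hn
    rw [dist_eq_norm] at h ⊢
    exact (abs_apply_le_norm (u n - u N) x).trans_lt h
  choose l hl using fun x => cauchySeq_tendsto_of_complete (hpt x)
  have key : ∀ ε > 0, ∃ N, ∀ n ≥ N, ∀ p : Family K, famSum (⇑(u n) - l) p ≤ ε := by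
    intro ε hε
    obtain ⟨N, hN⟩ := Metric.cauchySeq_iff.1 hu ε hε
    refine ⟨N, fun n hn p => ?_⟩
    have ht : Filter.Tendsto (fun m => famSum (u n - u m : Ambient K) p) Filter.atTop
        (nhds (famSum (⇑(u n) - l) p)) :=
      tendsto_finsetSum _ fun i _ => ((tendsto_const_nhds).sub (hl _)).abs
    refine le_of_tendsto ht (Filter.eventually_atTop.2 ⟨N, fun m hm => ?_⟩)
    have h := hN n hn m hm
    rw [dist_eq_norm] at h
    exact (famSum_le_norm _ p).trans h.le
  have hmem : l ∈ finiteNorm K := by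
    obtain ⟨N, hN⟩ := key 1 one_pos
    have h1 : (⇑(u N) - l) ∈ finiteNorm K :=
      ⟨1, by rintro _ ⟨p, rfl⟩; exact hN N le_rfl p⟩
    have h2 := (finiteNorm K).sub_mem (u N).2 h1
    rwa [sub_sub_cancel] at h2
  let l' : Ambient K := ⟨l, hmem⟩
  refine ⟨l', Metric.tendsto_atTop.2 fun ε hε => ?_⟩
  obtain ⟨N, hN⟩ := key (ε / 2) (half_pos hε)
  refine ⟨N, fun n hn => ?_⟩
  rw [dist_eq_norm (u n) l']
  exact (norm_le_of (f := u n - l') (hN n hn)).trans_lt (half_lt_self hε)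

instance : BanachLattice (Ambient K) where

end Ambient

/-- The evaluation function `δ_a(x) = x(a)`, an element of norm at most one. -/
noncomputable def delta (a : A) : Ambient K :=
  ⟨fun x => ((x : A → Set.Icc (-1 : ℝ) 1) a : ℝ), ⟨1, by rintro _ ⟨p, rfl⟩; exact p.2 a⟩⟩

variable {K} in
/-- Closed vector sublattices. -/
structure IsClosedSublattice (M : Submodule ℝ (Ambient K)) : Prop where
  closed : IsClosed (M : Set (Ambient K))
  sup_mem : ∀ f ∈ M, ∀ g ∈ M, f ⊔ g ∈ M
  inf_mem : ∀ f ∈ M, ∀ g ∈ M, f ⊓ g ∈ M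

/-- The Banach lattice generated by the evaluation functions `δ_a`, `a ∈ A`: the smallest closed
vector sublattice containing all of them. -/
noncomputable def generated : Submodule ℝ (Ambient K) :=
  sInf {M | IsClosedSublattice M ∧ ∀ a, delta K a ∈ M}

theorem mem_generated {f : Ambient K} :
    f ∈ generated K ↔ ∀ M, IsClosedSublattice M → (∀ a, delta K a ∈ M) → f ∈ M := by
  simp [generated, Submodule.mem_sInf]

theorem delta_mem_generated (a : A) : delta K a ∈ generated K :=
  (mem_generated K).2 fun _ _ h => h a

theorem isClosedSublattice_generated : IsClosedSublattice (generated K) where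
  closed := by
    rw [generated, Submodule.coe_sInf]
    exact isClosed_biInter fun M hM => hM.1.closed
  sup_mem f hf g hg := (mem_generated K).2 fun M h₁ h₂ =>
    h₁.sup_mem f ((mem_generated K).1 hf M h₁ h₂) g ((mem_generated K).1 hg M h₁ h₂)
  inf_mem f hf g hg := (mem_generated K).2 fun M h₁ h₂ =>
    h₁.inf_mem f ((mem_generated K).1 hf M h₁ h₂) g ((mem_generated K).1 hg M h₁ h₂)

noncomputable instance : Lattice (generated K) :=
  Subtype.lattice (P := fun f : Ambient K => f ∈ generated K)
    (fun _ _ hf hg => (isClosedSublattice_generated K).sup_mem _ hf _ hg)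
    (fun _ _ hf hg => (isClosedSublattice_generated K).inf_mem _ hf _ hg)

instance : PosSMulMono ℝ (generated K) where
  smul_le_smul_of_nonneg_left _ hr _ _ h :=
    smul_le_smul_of_nonneg_left (β := Ambient K) h hr

instance : HasSolidNorm (generated K) where
  solid f g h := HasSolidNorm.solid (α := Ambient K) (x := f) (y := g) h

instance : CompleteSpace (generated K) :=
  (isClosedSublattice_generated K).closed.completeSpace_coe

instance : BanachLattice (generated K) where

/-! Restriction of functions to a smaller set. -/

variable {K} {K' : Set (A → Set.Icc (-1 : ℝ) 1)}

/-- A family in `K` is a family in any larger set. -/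
def Family.incl (h : K ⊆ K') (p : Family K) : Family K' :=
  ⟨⟨p.1.1, fun i => Set.inclusion h (p.1.2 i)⟩, p.2⟩

theorem restrict_mem (h : K ⊆ K') (f : Ambient K') :
    (fun x : K => f (Set.inclusion h x)) ∈ finiteNorm K :=
  ⟨‖f‖, by rintro _ ⟨p, rfl⟩; exact Ambient.famSum_le_norm f (p.incl h)⟩

/-- The restriction map `f ↦ f|_K`, as a contraction between the spaces of functions of finite
norm. -/
noncomputable def ambientRestrict (h : K ⊆ K') : Ambient K' →L[ℝ] Ambient K :=
  LinearMap.mkContinuous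
    { toFun := fun f => ⟨fun x => f (Set.inclusion h x), restrict_mem h f⟩
      map_add' := fun _ _ => rfl
      map_smul' := fun _ _ => rfl } 1 fun f => by
    rw [one_mul]
    exact Ambient.norm_le_of fun p => Ambient.famSum_le_norm f (p.incl h)

theorem ambientRestrict_apply (h : K ⊆ K') (f : Ambient K') (x : K) :
    ambientRestrict h f x = f (Set.inclusion h x) := rfl

theorem ambientRestrict_mem (h : K ⊆ K') {f : Ambient K'} (hf : f ∈ generated K') :
    ambientRestrict h f ∈ generated K := by
  have hs := isClosedSublattice_generated K
  refine (mem_generated K').1 hf ((generated K).comap (ambientRestrict h).toLinearMap) ?_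
    fun a => delta_mem_generated K a
  exact
    { closed := hs.closed.preimage (ambientRestrict h).continuous
      sup_mem := fun f hf g hg => hs.sup_mem _ hf _ hg
      inf_mem := fun f hf g hg => hs.inf_mem _ hf _ hg }

/-- The restriction map `f ↦ f|_K` between the generated Banach lattices. -/
noncomputable def restrict (h : K ⊆ K') : generated K' →L[ℝ] generated K :=
  ((ambientRestrict h).comp (generated K').subtypeL).codRestrict (generated K)
    fun f => ambientRestrict_mem h f.2

theorem restrict_apply (h : K ⊆ K') (f : generated K') (x : K) :
    (restrict h f : Ambient K) x = (f : Ambient K') (Set.inclusion h x) := rfl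

end FBL

/-- The free Banach lattice `FBL(A)` generated by a set `A`, a space of functions on
`[-1,1]^A`. -/
abbrev FreeBLSet (A : Type*) : Type _ :=
  FBL.generated (Set.univ : Set (A → Set.Icc (-1 : ℝ) 1))

/-- The set `𝕃*` of lattice homomorphisms `𝕃 → [-1,1]`. -/
def latticeDual (L : Type*) [Lattice L] : Set (L → Set.Icc (-1 : ℝ) 1) :=
  {x | ∀ a b : L, (x (a ⊔ b) : ℝ) = max (x a : ℝ) (x b) ∧ (x (a ⊓ b) : ℝ) = min (x a : ℝ) (x b)}

/-- The free Banach lattice `FBL⟨𝕃⟩` generated by a lattice `𝕃`, a space of functions on `𝕃*`. -/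
abbrev FreeBLLattice (L : Type*) [Lattice L] : Type _ :=
  FBL.generated (latticeDual L)

/-- The restriction map `R : FBL(𝕃) → FBL⟨𝕃⟩`, `R f = f|_{𝕃*}`. -/
noncomputable def restrictionMap (L : Type*) [Lattice L] : FreeBLSet L →L[ℝ] FreeBLLattice L :=
  FBL.restrict (Set.subset_univ (latticeDual L))

/-! Constants are irrelevant to ∞-projectivity, so it is enough to know two extension properties up
to a constant: bounded maps from `𝕃` to a Banach lattice extend to `FBL(𝕃)`, and bounded lattice
homomorphisms extend to `FBL⟨𝕃⟩`. Given a section `v` of `R` and `T` into `X/J`, lift the values of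
`T` on the generators to bounded elements of `X`; these extend to `S` on `FBL(𝕃)` with `QS = TR`,
and `Sv` lifts `T`. Conversely, the classes of the `δ_a` in `FBL(𝕃)/ker R` form a lattice
homomorphism on `𝕃`. It extends to `FBL⟨𝕃⟩`, and any lift of the extension to `FBL(𝕃)` is a section
of `R`.

By density (`exists_hom`), extension reduces to bounding `‖t(φ)‖` by `‖t(δ)‖` for vector lattice
terms `t`. Such bounds come from scalar inequalities: in a principal ideal, real lattice
homomorphisms detect the order up to infinitesimals, and a Banach lattice has none. The
homomorphisms arise as minimal sup-preserving sublinear functionals below the gauge of the unit,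
which replaces Kakutani's representation theorem.

For arbitrary maps the scalar inequality is `|t(s)| ≤ ∑ l_a |s_a|` with `∑ l_a` close to `‖t(δ)‖`,
obtained by Hahn-Banach separation (`exists_weights`). For lattice homomorphisms, clamping between
the meet and the join of the variables turns each real homomorphism into a point of `𝕃*`, where `|t|
≤ ‖t(δ)‖`. -/

/-! ### Vector lattice terms -/

/-- Terms in the language of real vector lattices with variables in `A`. -/
inductive LatticeTerm (A : Type*) where
  | zero : LatticeTerm A
  | var : A → LatticeTerm A
  | add : LatticeTerm A → LatticeTerm A → LatticeTerm A
  | smul : ℝ → LatticeTerm A → LatticeTerm A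
  | sup : LatticeTerm A → LatticeTerm A → LatticeTerm A

namespace LatticeTerm

variable {A X Y : Type*} [AddCommGroup X] [Module ℝ X] [Lattice X]
  [AddCommGroup Y] [Module ℝ Y] [Lattice Y]

/-- The value of a term in a vector lattice. -/
def eval (φ : A → X) : LatticeTerm A → X
  | zero => 0
  | var a => φ a
  | add s t => s.eval φ + t.eval φ
  | smul c t => c • t.eval φ
  | sup s t => s.eval φ ⊔ t.eval φ

/-- The variables occurring in a term. -/
noncomputable def vars : LatticeTerm A → Finset A
  | zero => ∅
  | var a => {a}
  | add s t => by classical exact s.vars ∪ t.vars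
  | smul _ t => t.vars
  | sup s t => by classical exact s.vars ∪ t.vars

/-- This allows a map to be altered off the finitely many variables of a term: set to zero, or
clamped. -/
theorem eval_congr {φ ψ : A → X} (t : LatticeTerm A) (h : ∀ a ∈ t.vars, φ a = ψ a) :
    t.eval φ = t.eval ψ := by
  induction t with
  | zero => rfl
  | var a => exact h a (by simp [vars])
  | add s t hs ht =>
    simp only [vars, Finset.mem_union] at h
    simp only [eval, hs fun a ha => h a (Or.inl ha), ht fun a ha => h a (Or.inr ha)]
  | smul c t ht =>
    simp only [eval, ht h]
  | sup s t hs ht =>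
    simp only [vars, Finset.mem_union] at h
    simp only [eval, hs fun a ha => h a (Or.inl ha), ht fun a ha => h a (Or.inr ha)]

/-- Preserving suprema suffices, since infima are expressed in a vector lattice as `-(-x ⊔ -y)`. -/
theorem map_eval (T : X →ₗ[ℝ] Y) (hT : ∀ x y, T (x ⊔ y) = T x ⊔ T y) (φ : A → X)
    (t : LatticeTerm A) : T (t.eval φ) = t.eval fun a => T (φ a) := by
  induction t with
  | zero => exact map_zero T
  | var a => rfl
  | add s t hs ht => simp only [eval, map_add, hs, ht]
  | smul c t ht => simp only [eval, map_smul, ht]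
  | sup s t hs ht => simp only [eval, hT, hs, ht]

theorem eval_const_mul {c : ℝ} (hc : 0 ≤ c) (s : A → ℝ) (t : LatticeTerm A) :
    (t.eval fun a => c * s a) = c * t.eval s :=
  (t.map_eval (LinearMap.mulLeft ℝ c) (fun x y => mul_max_of_nonneg x y hc) s).symm

theorem eval_eq_zero [IsOrderedAddMonoid X] {φ : A → X} (t : LatticeTerm A)
    (h : ∀ a ∈ t.vars, φ a = 0) : t.eval φ = 0 := by
  induction t with
  | zero => rfl
  | var a => exact h a (by simp [vars])
  | add s t hs ht =>
    simp only [vars, Finset.mem_union] at h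
    simp [eval, hs fun a ha => h a (Or.inl ha), ht fun a ha => h a (Or.inr ha)]
  | smul c t ht => simp [eval, ht h]
  | sup s t hs ht =>
    simp only [vars, Finset.mem_union] at h
    simp [eval, hs fun a ha => h a (Or.inl ha), ht fun a ha => h a (Or.inr ha)]

end LatticeTerm

/-! ### Real lattice homomorphisms -/

section RealHom

variable {W : Type*} [AddCommGroup W] [Module ℝ W] [Lattice W]

/-- A sublinear functional on a vector lattice that preserves suprema. -/
structure IsSupSublinear (q : W → ℝ) : Prop where
  map_sup : ∀ x y, q (x ⊔ y) = q x ⊔ q y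
  add_le : ∀ x y, q (x + y) ≤ q x + q y
  map_smul : ∀ (c : ℝ) (x : W), 0 < c → q (c • x) = c * q x

namespace IsSupSublinear

variable {q : W → ℝ}

theorem map_zero (hq : IsSupSublinear q) : q 0 = 0 := by
  have := hq.map_smul 2 0 two_pos
  rw [smul_zero] at this
  linarith

theorem neg_le (hq : IsSupSublinear q) (x : W) : -q (-x) ≤ q x := by
  have := hq.add_le x (-x)
  rw [add_neg_cancel, hq.map_zero] at this
  linarith

theorem map_nonneg_smul (hq : IsSupSublinear q) {c : ℝ} (hc : 0 ≤ c) (x : W) :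
    q (c • x) = c * q x := by
  rcases hc.eq_or_lt with rfl | hc
  · simp [hq.map_zero]
  · exact hq.map_smul _ _ hc

/-- An infimum commutes with finite suprema along a downward directed family. The other laws need
only hold after a change of index. This serves both a family of translates and the chains in Zorn's
lemma. -/
theorem iInf_of_directed {ι : Type*} [Nonempty ι] {Q : ι → W → ℝ}
    (hbdd : ∀ x, BddBelow (Set.range fun i => Q i x)) (hdir : ∀ i j, ∃ k, Q k ≤ Q i ∧ Q k ≤ Q j)
    (hsup : ∀ i x y, Q i (x ⊔ y) = Q i x ⊔ Q i y)
    (hadd : ∀ i j x y, ∃ k, Q k (x + y) ≤ Q i x + Q j y)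
    (hsmul : ∀ (c : ℝ) i x, 0 < c → ∃ j, Q j (c • x) ≤ c * Q i x) :
    IsSupSublinear fun x => ⨅ i, Q i x where
  map_sup x y := by
    refine le_antisymm (le_of_forall_pos_lt_add fun ε hε => ?_) (sup_le ?_ ?_)
    · obtain ⟨i, hi⟩ := exists_lt_of_ciInf_lt (lt_add_of_pos_right (⨅ i, Q i x) hε)
      obtain ⟨j, hj⟩ := exists_lt_of_ciInf_lt (lt_add_of_pos_right (⨅ i, Q i y) hε)
      obtain ⟨k, hki, hkj⟩ := hdir i j
      refine (ciInf_le (hbdd _) k).trans_lt ?_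
      rw [hsup, ← max_add_add_right]
      exact max_lt_max ((hki x).trans_lt hi) ((hkj y).trans_lt hj)
    · refine le_ciInf fun i => (ciInf_le (hbdd _) i).trans ?_
      rw [hsup]
      exact le_sup_left
    · refine le_ciInf fun i => (ciInf_le (hbdd _) i).trans ?_
      rw [hsup]
      exact le_sup_right
  add_le x y := by
    refine le_ciInf_add_ciInf fun i j => ?_
    obtain ⟨k, hk⟩ := hadd i j x y
    exact (ciInf_le (hbdd _) k).trans hk
  map_smul := by
    have key : ∀ (c : ℝ) (x : W), 0 < c → (⨅ i, Q i (c • x)) ≤ c * ⨅ i, Q i x := by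
      intro c x hc
      rw [Real.mul_iInf_of_nonneg hc.le]
      refine le_ciInf fun i => ?_
      obtain ⟨j, hj⟩ := hsmul c i x hc
      exact (ciInf_le (hbdd _) j).trans hj
    intro c x hc
    refine le_antisymm (key c x hc) ?_
    have := key c⁻¹ (c • x) (inv_pos.2 hc)
    rwa [inv_smul_smul₀ hc.ne', le_inv_mul_iff₀ hc] at this

/-- The functional `y ↦ inf_r (q (y + r x) - r q(x))`: if `q` is the supremum over a compact set of
points, this is the supremum over the subset on which `x` attains its maximum. -/
theorem exists_le_map_neg [IsOrderedAddMonoid W] [PosSMulMono ℝ W] (hq : IsSupSublinear q)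
    (x : W) : ∃ p : W → ℝ, IsSupSublinear p ∧ p ≤ q ∧ p (-x) ≤ -q x := by
  let Q : NNReal → W → ℝ := fun r y => q (y + (r : ℝ) • x) - r * q x
  have hbdd : ∀ y, BddBelow (Set.range fun r => Q r y) := by
    refine fun y => ⟨-q (-y), ?_⟩
    rintro _ ⟨r, rfl⟩
    have := hq.add_le (y + (r : ℝ) • x) (-y)
    rw [add_neg_cancel_comm, hq.map_nonneg_smul r.coe_nonneg] at this
    simp only [Q]
    linarith
  -- By subadditivity the family decreases in `r`, hence is directed.
  have hanti : ∀ r s, Q (r + s) ≤ Q r := by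
    intro r s y
    have := hq.add_le (y + (r : ℝ) • x) ((s : ℝ) • x)
    rw [hq.map_nonneg_smul s.coe_nonneg, add_assoc, ← add_smul] at this
    simp only [Q, NNReal.coe_add]
    linarith
  refine ⟨fun y => ⨅ r, Q r y, iInf_of_directed hbdd
    (fun r s => ⟨r + s, hanti r s, add_comm s r ▸ hanti s r⟩) (fun r y z => ?_)
    (fun r s y z => ⟨r + s, ?_⟩) (fun c r y hc => ⟨c.toNNReal * r, ?_⟩), fun y => ?_, ?_⟩
  · simp only [Q]
    rw [sup_add, hq.map_sup, max_sub_sub_right]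
  · have := hq.add_le (y + (r : ℝ) • x) (z + (s : ℝ) • x)
    rw [add_add_add_comm, ← add_smul] at this
    simp only [Q, NNReal.coe_add]
    linarith
  · simp only [Q, NNReal.coe_mul, Real.coe_toNNReal c hc.le]
    rw [mul_smul, ← smul_add, hq.map_smul _ _ hc]
    linarith
  -- The index `0` gives `p ≤ q`; below, the index `1` at `-x` gives `q 0 - q x`.
  · refine (ciInf_le (hbdd y) 0).trans (le_of_eq ?_)
    simp [Q]
  · refine (ciInf_le (hbdd _) 1).trans (le_of_eq ?_)
    simp [Q, hq.map_zero]

/-- A sublinear functional that preserves suprema dominates a linear one, which may be prescribed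
to attain the same value at a given point. -/
theorem exists_linear_le [IsOrderedAddMonoid W] [PosSMulMono ℝ W] (hq : IsSupSublinear q)
    (z : W) : ∃ ω : W →ₗ[ℝ] ℝ, (∀ x y, ω (x ⊔ y) = ω x ⊔ ω y) ∧ (∀ x, ω x ≤ q x) ∧
      ω z = q z := by
  -- Since `p (-z) ≤ -q z`, every linear functional below `p` is at least `q z` at `z`.
  obtain ⟨p, hp, hpq, hpz⟩ := hq.exists_le_map_neg z
  obtain ⟨m, hpm, hm⟩ := zorn_le_nonempty₀ (α := (W → ℝ)ᵒᵈ)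
    {r | IsSupSublinear (OrderDual.ofDual r)} (fun c hc hchain y hy => by
      have : Nonempty c := ⟨⟨y, hy⟩⟩
      have hbdd : ∀ x, BddBelow (Set.range fun r : c => OrderDual.ofDual r.1 x) := by
        -- A single member `y` bounds the whole chain: members below `y` are compared at `-x`,
        -- members above it at `x`.
        refine fun x => ⟨-(OrderDual.ofDual y (-x)), ?_⟩
        rintro _ ⟨r, rfl⟩
        have h1 := (hc r.2).neg_le x
        have h2 := (hc hy).neg_le x
        rcases hchain.total hy r.2 with h | h
        · have := h (-x)
          exact (neg_le_neg this).trans h1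
        · exact h2.trans (h x)
      refine ⟨OrderDual.toDual fun x => ⨅ r : c, OrderDual.ofDual r.1 x, iInf_of_directed hbdd
        (fun r s => ?_) (fun r => (hc r.2).map_sup) (fun r s x y => ?_)
        (fun a r x ha => ⟨r, ((hc r.2).map_smul a x ha).le⟩),
        fun r hr x => ciInf_le (hbdd x) ⟨r, hr⟩⟩
      · rcases hchain.total r.2 s.2 with h | h
        · exact ⟨s, h, le_rfl⟩
        · exact ⟨r, le_rfl, h⟩
      · rcases hchain.total r.2 s.2 with h | h
        · exact ⟨s, ((hc s.2).add_le x y).trans (add_le_add_left (h x) _)⟩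
        · exact ⟨r, ((hc r.2).add_le x y).trans (add_le_add_right (h y) _)⟩)
    (OrderDual.toDual p) hp
  set w : W → ℝ := OrderDual.ofDual m
  have hw : IsSupSublinear w := hm.1
  have hwp : w ≤ p := hpm
  have hneg : ∀ x, w (-x) = -w x := by
    intro x
    -- Minimality forces `w ≤ r`, so `w (-x) ≤ -w x`. An odd sublinear functional is linear.
    obtain ⟨r, hr, hrw, hrx⟩ := hw.exists_le_map_neg x
    have h1 : w ≤ r := hm.2 (y := OrderDual.toDual r) hr hrw
    linarith [h1 (-x), hw.neg_le x]
  have hadd : ∀ x y, w (x + y) = w x + w y := by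
    intro x y
    refine le_antisymm (hw.add_le x y) ?_
    have := hw.add_le (-x) (-y)
    rw [← neg_add, hneg, hneg, hneg] at this
    linarith
  refine ⟨{ toFun := w, map_add' := hadd, map_smul' := fun c x => ?_ }, hw.map_sup,
    fun x => (hwp x).trans (hpq x), le_antisymm ((hwp z).trans (hpq z)) ?_⟩
  · rcases le_total 0 c with hc | hc
    · exact hw.map_nonneg_smul hc x
    · have := hw.map_nonneg_smul (neg_nonneg.2 hc) x
      rw [neg_smul, hneg] at this
      simp only [RingHom.id_apply, smul_eq_mul]
      linarith
  · have := (hwp (-z)).trans hpz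
    rw [hneg] at this
    exact neg_le_neg_iff.1 this

end IsSupSublinear

/-- In a vector lattice with a strong unit `e`, the real lattice homomorphisms `ω` with `ω e = 1`
determine the order, up to infinitesimals. -/
theorem le_smul_unit_of_forall_realHom [IsOrderedAddMonoid W] [PosSMulMono ℝ W] {e : W}
    (he : 0 ≤ e) (hunit : ∀ x : W, ∃ t : ℝ, x ≤ t • e) {z : W}
    (h : ∀ ω : W →ₗ[ℝ] ℝ, (∀ x y, ω (x ⊔ y) = ω x ⊔ ω y) → ω e = 1 → ω z ≤ 0)
    {t : ℝ} (ht : 0 < t) : z ≤ t • e := by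
  by_contra hz
  have mono : ∀ {s t : ℝ}, s ≤ t → s • e ≤ t • e := fun {s t} hst => by
    rw [← sub_nonneg, ← sub_smul]
    exact smul_nonneg (sub_nonneg.2 hst) he
  -- This could fail only for `e = 0`, but then `hunit` would give `z ≤ 0`, contrary to `hz`.
  have hnonneg : ∀ t : ℝ, 0 ≤ t • e → 0 ≤ t := by
    intro s hs
    by_contra! hneg
    have he0 : e = 0 := by
      refine le_antisymm ?_ he
      have := smul_nonneg (inv_nonneg.2 (neg_nonneg.2 hneg.le)) hs
      rw [smul_smul, inv_neg, neg_mul, inv_mul_cancel₀ hneg.ne, neg_smul, one_smul] at this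
      exact neg_nonneg.1 this
    obtain ⟨r, hr⟩ := hunit z
    rw [he0, smul_zero] at hr
    rw [he0, smul_zero] at hz
    exact hz hr
  let S : W → Set ℝ := fun x => {t | x ≤ t • e}
  -- The gauge of `e`; it preserves suprema because `x ⊔ y ≤ t • e` means that both `x` and `y` lie
  -- below `t • e`.
  let q : W → ℝ := fun x => sInf (S x)
  have hbdd : ∀ x, BddBelow (S x) := by
    intro x
    obtain ⟨s, hs⟩ := hunit (-x)
    refine ⟨-s, fun t ht => ?_⟩
    have := hnonneg (t + s) (by
      rw [add_smul]
      have := add_le_add ht hs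
      rwa [add_neg_cancel] at this)
    linarith
  have hq_le : ∀ {x : W} {t : ℝ}, x ≤ t • e → q x ≤ t := fun ht => csInf_le (hbdd _) ht
  have hlt : ∀ {x : W} {t : ℝ}, q x < t → x ≤ t • e := by
    intro x t ht
    obtain ⟨s, hs, hst⟩ := exists_lt_of_csInf_lt (hunit x) ht
    exact le_trans hs (mono hst.le)
  have hq_mono : ∀ {x y : W}, x ≤ y → q x ≤ q y := fun {x y} hxy =>
    le_of_forall_gt_imp_ge_of_dense fun t ht => hq_le (hxy.trans (hlt ht))
  have hsmul : ∀ (c : ℝ) (x : W), 0 < c → q (c • x) ≤ c * q x := by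
    intro c x hc
    rw [← div_le_iff₀' hc]
    refine le_of_forall_gt_imp_ge_of_dense fun t ht => ?_
    rw [div_le_iff₀' hc]
    refine hq_le ?_
    rw [mul_smul]
    exact smul_le_smul_of_nonneg_left (hlt ht) hc.le
  have hq : IsSupSublinear q :=
    { map_sup := fun x y => by
        refine le_antisymm (le_of_forall_gt_imp_ge_of_dense fun t ht => hq_le ?_)
          (sup_le (hq_mono le_sup_left) (hq_mono le_sup_right))
        exact sup_le (hlt (le_sup_left.trans_lt ht)) (hlt (le_sup_right.trans_lt ht))
      add_le := fun x y => by
        refine le_of_forall_pos_lt_add fun ε hε => ?_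
        have := hq_le (x := x + y) (t := (q x + ε / 3) + (q y + ε / 3)) (by
          rw [add_smul]
          exact add_le_add (hlt (by linarith)) (hlt (by linarith)))
        linarith
      map_smul := fun c x hc => by
        refine le_antisymm (hsmul c x hc) ?_
        have := hsmul c⁻¹ (c • x) (inv_pos.2 hc)
        rwa [inv_smul_smul₀ hc.ne', le_inv_mul_iff₀ hc] at this }
  obtain ⟨ω, hsup, hωq, hωz⟩ := hq.exists_linear_le z
  have hωe : ω e = 1 := by
    refine le_antisymm ((hωq e).trans (hq_le (one_smul ℝ e).ge)) ?_
    have := (hωq (-e)).trans (hq_le (t := -1) (by rw [neg_smul, one_smul]))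
    rw [map_neg] at this
    linarith
  have hpos : t ≤ q z := by
    by_contra! hlt'
    exact hz (hlt hlt')
  linarith [h ω hsup hωe]

end RealHom

/-! ### Principal ideals of Banach lattices -/

section PrincipalIdeal

variable {X : Type*} [NormedAddCommGroup X] [NormedSpace ℝ X] [Lattice X] [BanachLattice X]

/-- The principal ideal generated by a positive element. -/
def principalIdeal (e : X) : Submodule ℝ X where
  carrier := {x | ∃ t : ℝ, |x| ≤ t • e}
  zero_mem' := ⟨0, by simp⟩
  add_mem' := by
    rintro x y ⟨s, hs⟩ ⟨t, ht⟩
    refine ⟨s + t, (abs_add_le x y).trans ?_⟩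
    rw [add_smul]
    exact add_le_add hs ht
  smul_mem' := by
    rintro c x ⟨t, ht⟩
    have key : ∀ {c : ℝ} {x : X}, 0 ≤ c → |x| ≤ t • e → |c • x| ≤ (c * t) • e := by
      intro c x hc hx
      rw [mul_smul]
      obtain ⟨h1, h2⟩ := abs_le'.1 hx
      refine abs_le'.2 ⟨smul_le_smul_of_nonneg_left h1 hc, ?_⟩
      rw [← smul_neg]
      exact smul_le_smul_of_nonneg_left h2 hc
    rcases le_total 0 c with hc | hc
    · exact ⟨c * t, key hc ht⟩
    · refine ⟨-c * t, ?_⟩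
      rw [← abs_neg, ← neg_smul]
      exact key (neg_nonneg.2 hc) ht

namespace principalIdeal

variable {e : X}

theorem mem_of_abs_le_unit {x : X} (h : |x| ≤ e) : x ∈ principalIdeal e :=
  ⟨1, by rwa [one_smul]⟩

theorem sup_mem {x y : X} (hx : x ∈ principalIdeal e) (hy : y ∈ principalIdeal e) :
    x ⊔ y ∈ principalIdeal e := by
  obtain ⟨s, hs⟩ := hx
  obtain ⟨t, ht⟩ := hy
  refine ⟨s + t, le_trans ?_ ((add_le_add hs ht).trans_eq (add_smul s t e).symm)⟩
  refine abs_le'.2 ⟨sup_le ?_ ?_, ?_⟩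
  · exact (le_abs_self x).trans (le_add_of_nonneg_right (abs_nonneg y))
  · exact (le_abs_self y).trans (le_add_of_nonneg_left (abs_nonneg x))
  · exact (neg_le_neg le_sup_left).trans
      ((neg_le_abs x).trans (le_add_of_nonneg_right (abs_nonneg y)))

theorem inf_mem {x y : X} (hx : x ∈ principalIdeal e) (hy : y ∈ principalIdeal e) :
    x ⊓ y ∈ principalIdeal e := by
  have := (principalIdeal e).neg_mem
    (sup_mem ((principalIdeal e).neg_mem hx) ((principalIdeal e).neg_mem hy))
  rwa [neg_sup, neg_neg, neg_neg] at this

instance : Lattice (principalIdeal e) :=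
  Subtype.lattice (P := fun x : X => x ∈ principalIdeal e) (fun _ _ => sup_mem) fun _ _ => inf_mem

instance : PosSMulMono ℝ (principalIdeal e) where
  smul_le_smul_of_nonneg_left _ hr _ _ h := smul_le_smul_of_nonneg_left (β := X) h hr

theorem coe_abs (x : principalIdeal e) : ((|x| : principalIdeal e) : X) = |(x : X)| := rfl

theorem coe_eval {A : Type*} (φ : A → principalIdeal e) (t : LatticeTerm A) :
    ((t.eval φ : principalIdeal e) : X) = t.eval fun a => (φ a : X) :=
  t.map_eval (principalIdeal e).subtype (fun _ _ => rfl) φ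

/-- The generator as an element of the principal ideal. -/
def unit (he : 0 ≤ e) : principalIdeal e := ⟨e, mem_of_abs_le_unit (abs_of_nonneg he).le⟩

/-- Homomorphisms commute with terms, so the scalar inequality passes to the ideal, where `e` is a
strong unit, with an error `s • e` for every `s > 0`. The error disappears as `s → 0` because the
positive cone of `X` is closed. -/
theorem abs_eval_le_of_forall_realHom {A : Type*} (he : 0 ≤ e) (φ : A → principalIdeal e)
    (t : LatticeTerm A) (v : principalIdeal e)
    (h : ∀ ω : principalIdeal e →ₗ[ℝ] ℝ, (∀ x y, ω (x ⊔ y) = ω x ⊔ ω y) → ω (unit he) = 1 →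
      |t.eval fun a => ω (φ a)| ≤ ω v) :
    |t.eval fun a => (φ a : X)| ≤ v := by
  have key : ∀ s : ℝ, 0 < s → |t.eval φ| - v ≤ s • unit he := by
    intro s hs
    refine le_smul_unit_of_forall_realHom (e := unit he) he (fun x => ?_) (fun ω hω hωe => ?_) hs
    · obtain ⟨r, hr⟩ := x.2
      exact ⟨r, (le_abs_self (x : X)).trans hr⟩
    · rw [map_sub, abs, hω, map_neg, t.map_eval ω hω]
      exact sub_nonpos.2 (h ω hω hωe)
  have hlim : Filter.Tendsto (fun s : ℝ => s • e) (nhdsWithin 0 (Set.Ioi 0)) (nhds ((0 : ℝ) • e)) :=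
    ((continuous_id.smul continuous_const).tendsto 0).mono_left nhdsWithin_le_nhds
  rw [zero_smul] at hlim
  refine sub_nonpos.1 (ge_of_tendsto hlim ?_)
  filter_upwards [self_mem_nhdsWithin] with s hs
  rw [← coe_eval]
  exact key s hs

end principalIdeal

end PrincipalIdeal

/-! ### Norm estimates for terms -/

namespace FBL

variable {A : Type*} {K : Set (A → Set.Icc (-1 : ℝ) 1)}

/-- The value of a term at the evaluation functions is computed pointwise. -/
theorem eval_delta_apply (t : LatticeTerm A) (x : K) :
    (t.eval (delta K)) x = t.eval fun a => ((x : A → Set.Icc (-1 : ℝ) 1) a : ℝ) :=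
  t.map_eval (Y := ℝ)
    { toFun := fun f : Ambient K => f x, map_add' := fun _ _ => rfl, map_smul' := fun _ _ => rfl }
    (fun _ _ => rfl) (delta K)

/-- A term function on `[-1,1]^A` is dominated by a positive combination of absolute values of
coordinates, with weights of total mass close to the norm. -/
theorem exists_weights (t : LatticeTerm A) {γ : ℝ}
    (hγ : ‖t.eval (delta (Set.univ : Set (A → Set.Icc (-1 : ℝ) 1)))‖ < γ) :
    ∃ l : A → ℝ, (∀ a, 0 ≤ l a) ∧ ∑ a ∈ t.vars, l a ≤ γ ∧
      ∀ s : A → ℝ, |t.eval s| ≤ ∑ a ∈ t.vars, l a * |s a| := by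
  classical
  have hγ0 : 0 < γ := (norm_nonneg _).trans_lt hγ
  rcases t.vars.eq_empty_or_nonempty with hF | hF
  · refine ⟨0, fun _ => le_rfl, by simpa using hγ0.le, fun s => ?_⟩
    rw [t.eval_eq_zero (φ := s) (by simp [hF])]
    simp
  set F := t.vars with hFdef
  have : Nonempty F := hF.to_subtype
  -- The weights sought are a nonnegative functional of positive mass that is nonnegative on all
  -- these vectors. It exists once their convex hull misses the open negative orthant `U`.
  let v : (A → ℝ) → F → ℝ := fun s a => γ * |s a| - |t.eval s|
  let U : Set (F → ℝ) := {y | ∀ a, y a < 0}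
  have hUo : IsOpen U := by
    have : U = ⋂ a, {y | y a < 0} := by ext; simp [U]
    rw [this]
    exact isOpen_iInter_of_finite fun a => isOpen_lt (continuous_apply a) continuous_const
  have hUc : Convex ℝ U := by
    intro x hx y hy a b ha hb hab i
    have h1 := hx i
    have h2 := hy i
    simp only [Pi.add_apply, Pi.smul_apply, smul_eq_mul]
    rcases ha.eq_or_lt with rfl | ha
    · rw [zero_add] at hab
      subst hab
      linarith
    · nlinarith
  have hdisj : Disjoint U (convexHull ℝ (Set.range v)) := by
    refine Set.disjoint_left.2 fun y hyU hy => ?_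
    obtain ⟨ι, _, w, z, hw, -, hz, rfl⟩ := mem_convexHull_iff_exists_fintype.1 hy
    choose s hs using hz
    let E := ∑ i, w i * |t.eval (s i)|
    have hsum : ∀ a : F, ∑ i, γ * w i * |s i a| < E := by
      intro a
      have := hyU a
      simp only [Finset.sum_apply, Pi.smul_apply, smul_eq_mul, ← hs, v, mul_sub,
        Finset.sum_sub_distrib] at this
      refine lt_of_eq_of_lt (Finset.sum_congr rfl fun i _ => ?_) (sub_neg.1 this)
      ring
    have hE : 0 < E := (Finset.sum_nonneg fun i _ =>
      mul_nonneg (mul_nonneg hγ0.le (hw i)) (abs_nonneg _)).trans_lt (hsum (Classical.arbitrary F))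
    -- With this scaling the points form an admissible family, and positive homogeneity gives `∑
    -- |t(x_i)| = γ`, more than the norm of the term function.
    let x : ι → A → ℝ := fun i a => if a ∈ F then γ * w i / E * s i a else 0
    have hc : ∀ i, 0 ≤ γ * w i / E := fun i => div_nonneg (mul_nonneg hγ0.le (hw i)) hE.le
    have hx : ∀ a, ∑ i, |x i a| ≤ 1 := by
      intro a
      by_cases ha : a ∈ F
      · have h1 : ∑ i, |x i a| = (∑ i, γ * w i * |s i a|) / E := by
          rw [Finset.sum_div]
          refine Finset.sum_congr rfl fun i _ => ?_
          simp only [x, if_pos ha, abs_mul, abs_of_nonneg (hc i)]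
          ring
        rw [h1, div_le_one hE]
        exact (hsum ⟨a, ha⟩).le
      · simp [x, ha]
    have hx1 : ∀ i a, x i a ∈ Set.Icc (-1 : ℝ) 1 := fun i a =>
      abs_le.1 ((Finset.single_le_sum (f := fun i => |x i a|) (fun _ _ => abs_nonneg _)
        (Finset.mem_univ i)).trans (hx a))
    let e := (Fintype.equivFin ι).symm
    let p : Family (Set.univ : Set (A → Set.Icc (-1 : ℝ) 1)) :=
      ⟨⟨Fintype.card ι, fun i => ⟨fun a => ⟨x (e i) a, hx1 _ a⟩, trivial⟩⟩, fun a =>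
        (e.sum_comp fun i => |x i a|).trans_le (hx a)⟩
    let g : Ambient (Set.univ : Set (A → Set.Icc (-1 : ℝ) 1)) := t.eval (delta _)
    have hp : famSum g p = γ := by
      have h1 : ∀ i, |t.eval (x i)| = γ / E * (w i * |t.eval (s i)|) := by
        intro i
        rw [t.eval_congr (φ := x i) (ψ := fun a => γ * w i / E * s i a) fun a ha => if_pos ha,
          t.eval_const_mul (hc i), abs_mul, abs_of_nonneg (hc i)]
        ring
      have h2 : famSum g p = ∑ i, |t.eval (x (e i))| :=
        Finset.sum_congr rfl fun i _ => congrArg abs (eval_delta_apply t _)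
      rw [h2, e.sum_comp fun i => |t.eval (x i)|]
      simp_rw [h1]
      rw [← Finset.mul_sum]
      exact div_mul_cancel₀ γ hE.ne'
    exact absurd (Ambient.famSum_le_norm g p) (by rw [hp]; exact hγ.not_ge)
  obtain ⟨f, c, hfU, hfv⟩ := geometric_hahn_banach_open hUc hUo (convex_convexHull ℝ _) hdisj
  replace hfv : ∀ s, c ≤ f (v s) := fun s => hfv _ (subset_convexHull ℝ _ ⟨s, rfl⟩)
  have hone : ∀ ε : ℝ, 0 < ε → -ε * f 1 < c := by
    intro ε hε
    have := hfU (-ε • 1) fun a => by simpa using hε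
    rwa [map_smul] at this
  have hc0 : c = 0 := by
    refine le_antisymm ?_ ?_
    · have h0 : v 0 = 0 := by
        ext a
        simp [v, t.eval_eq_zero (φ := (0 : A → ℝ)) fun _ _ => rfl]
      have := hfv 0
      rwa [h0, map_zero] at this
    · have hlim : Filter.Tendsto (fun ε : ℝ => -ε * f 1) (nhdsWithin 0 (Set.Ioi 0))
          (nhds (-0 * f 1)) :=
        ((continuous_neg.mul continuous_const).tendsto 0).mono_left nhdsWithin_le_nhds
      rw [neg_zero, zero_mul] at hlim
      refine le_of_tendsto hlim ?_
      filter_upwards [self_mem_nhdsWithin] with ε hε using (hone ε hε).le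
  subst hc0
  let m : F → ℝ := fun a => f (Pi.single a 1)
  have hfm : ∀ y : F → ℝ, f y = ∑ a, m a * y a := by
    intro y
    conv_lhs => rw [← Finset.univ_sum_single y]
    rw [map_sum]
    refine Finset.sum_congr rfl fun a _ => ?_
    rw [show (Pi.single a (y a) : F → ℝ) = y a • Pi.single a 1 by
      rw [← Pi.single_smul, smul_eq_mul, mul_one], map_smul, smul_eq_mul, mul_comm]
  have hf1 : 0 < f 1 := by linarith [hone 1 one_pos]
  have hm : ∀ a, 0 ≤ m a := by
    intro a
    by_contra! hneg
    -- The coefficient is chosen so that `f` vanishes at this point of `U`, where it should be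
    -- negative.
    have h := hfU (-(1 : F → ℝ) - (f 1 / -m a) • Pi.single a 1) fun b => by
      have : 0 ≤ (f 1 / -m a) * (Pi.single a (1 : ℝ) : F → ℝ) b := by
        refine mul_nonneg (div_nonneg hf1.le (neg_nonneg.2 hneg.le)) ?_
        by_cases hab : b = a
        · subst hab; simp
        · simp [hab]
      simp only [Pi.sub_apply, Pi.neg_apply, Pi.one_apply, Pi.smul_apply, smul_eq_mul]
      linarith
    rw [map_sub, map_neg, map_smul, smul_eq_mul] at h
    have h2 : f 1 / -m a * f (Pi.single a 1) = -f 1 := by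
      change f 1 / -m a * m a = _
      field_simp [hneg.ne]
    linarith
  have hm1 : f 1 = ∑ a, m a := by simp [hfm]
  refine ⟨fun a => if h : a ∈ F then γ / f 1 * m ⟨a, h⟩ else 0, fun a => ?_, ?_, fun s => ?_⟩
  · dsimp only
    split_ifs with h
    · exact mul_nonneg (div_nonneg hγ0.le hf1.le) (hm _)
    · exact le_rfl
  · rw [← Finset.sum_coe_sort]
    simp only [Finset.coe_mem, dif_pos, Subtype.coe_eta]
    rw [← Finset.mul_sum, ← hm1, div_mul_cancel₀ _ hf1.ne']
  · rw [← Finset.sum_coe_sort]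
    simp only [Finset.coe_mem, dif_pos, Subtype.coe_eta]
    have h := hfv s
    simp only [hfm, v, mul_sub, Finset.sum_sub_distrib] at h
    rw [← Finset.sum_mul, ← hm1] at h
    have h3 : ∑ a : F, γ / f 1 * m a * |s a| = (∑ a : F, m a * (γ * |s a|)) / f 1 := by
      rw [Finset.sum_div]
      exact Finset.sum_congr rfl fun a _ => by ring
    rw [h3, le_div_iff₀ hf1]
    linarith

section Bounds

variable {X : Type*} [NormedAddCommGroup X] [NormedSpace ℝ X] [Lattice X] [BanachLattice X]

/-- A bounded map from a set to a Banach lattice satisfies the norm estimate required of the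
free Banach lattice over that set. -/
theorem norm_eval_le_of_bounded {φ : A → X} {C : ℝ} (hC : 0 ≤ C) (hφ : ∀ a, ‖φ a‖ ≤ C)
    (t : LatticeTerm A) :
    ‖t.eval φ‖ ≤ C * ‖t.eval (delta (Set.univ : Set (A → Set.Icc (-1 : ℝ) 1)))‖ := by
  classical
  have key : ∀ γ, ‖t.eval (delta (Set.univ : Set (A → Set.Icc (-1 : ℝ) 1)))‖ < γ →
      ‖t.eval φ‖ ≤ C * γ := by
    intro γ hγ
    obtain ⟨l, hl, hlγ, hlt⟩ := exists_weights t hγ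
    -- All the values of `φ` at variables of `t` lie in the principal ideal of `e`. The norm of `e`
    -- plays no role.
    let e : X := ∑ a ∈ t.vars, |φ a|
    have he : 0 ≤ e := Finset.sum_nonneg fun a _ => abs_nonneg _
    have hmem : ∀ a ∈ t.vars, φ a ∈ principalIdeal e := fun a ha =>
      principalIdeal.mem_of_abs_le_unit
        (Finset.single_le_sum (f := fun a => |φ a|) (fun _ _ => abs_nonneg _) ha)
    let ψ : A → principalIdeal e := fun a => if h : a ∈ t.vars then ⟨φ a, hmem a h⟩ else 0
    have hψ : ∀ a ∈ t.vars, (ψ a : X) = φ a := fun a ha => by simp [ψ, ha]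
    have h := principalIdeal.abs_eval_le_of_forall_realHom he ψ t
      (∑ a ∈ t.vars, l a • |ψ a|) fun ω hω _ => by
        simpa only [map_sum, map_smul, smul_eq_mul, abs, hω, map_neg] using hlt fun a => ω (ψ a)
    rw [t.eval_congr hψ] at h
    calc ‖t.eval φ‖ ≤ ‖((∑ a ∈ t.vars, l a • |ψ a| : principalIdeal e) : X)‖ :=
          norm_le_norm_of_abs_le_abs (h.trans (le_abs_self _))
      _ = ‖∑ a ∈ t.vars, l a • |φ a|‖ := by
          congr 1
          rw [AddSubmonoidClass.coe_finsetSum]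
          refine Finset.sum_congr rfl fun a ha => ?_
          rw [Submodule.coe_smul, principalIdeal.coe_abs, hψ a ha]
      _ ≤ ∑ a ∈ t.vars, l a * C := norm_sum_le_of_le _ fun a _ => by
          rw [norm_smul, norm_abs_eq_norm, Real.norm_of_nonneg (hl a)]
          exact mul_le_mul_of_nonneg_left (hφ a) (hl a)
      _ ≤ C * γ := by
          rw [← Finset.sum_mul, mul_comm]
          exact mul_le_mul_of_nonneg_left hlγ hC
  refine le_of_forall_pos_le_add fun ε hε => ?_
  -- Dividing by `C + 1` instead of `C` allows `C = 0`.
  refine (key (_ + ε / (C + 1)) (lt_add_of_pos_right _ (by positivity))).trans ?_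
  rw [mul_add]
  gcongr
  rw [mul_div_left_comm]
  exact mul_le_of_le_one_right hε.le ((div_le_one (by positivity)).2 (by linarith))

/-- A bounded lattice homomorphism from a distributive lattice to a Banach lattice satisfies, up to
a factor `2`, the norm estimate required of the free Banach lattice over that lattice. -/
theorem norm_eval_le_of_latticeHom {L : Type*} [DistribLattice L] {φ : L → X} {C : ℝ}
    (hφ : ∀ a, ‖φ a‖ ≤ C) (hsup : ∀ a b, φ (a ⊔ b) = φ a ⊔ φ b)
    (hinf : ∀ a b, φ (a ⊓ b) = φ a ⊓ φ b) (t : LatticeTerm L) :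
    ‖t.eval φ‖ ≤ 2 * C * ‖t.eval (delta (latticeDual L))‖ := by
  rcases t.vars.eq_empty_or_nonempty with hF | hF
  · rw [t.eval_eq_zero (φ := φ) (by simp [hF]), t.eval_eq_zero (φ := delta _) (by simp [hF])]
    simp
  let bot : L := t.vars.inf' hF id
  let top : L := t.vars.sup' hF id
  -- By distributivity this is a lattice homomorphism, and it fixes the variables of `t`. After it,
  -- `φ` maps all of `L` into one order interval.
  let clamp : L → L := fun a => (a ⊔ bot) ⊓ top
  have hbt : bot ≤ top :=
    (Finset.inf'_le id hF.choose_spec).trans (Finset.le_sup' id hF.choose_spec)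
  have hclamp : ∀ a ∈ t.vars, clamp a = a := fun a ha => by
    have h1 : bot ≤ a := Finset.inf'_le id ha
    have h2 : a ≤ top := Finset.le_sup' id ha
    simp only [clamp]
    rw [sup_eq_left.2 h1, inf_eq_left.2 h2]
  have mono : ∀ {a b}, a ≤ b → φ a ≤ φ b := fun {a b} hab => by
    rw [← sup_eq_right, ← hsup, sup_eq_right.2 hab]
  -- These two summands account for the factor `2`.
  let e : X := |φ bot| + |φ top|
  have he : 0 ≤ e := add_nonneg (abs_nonneg _) (abs_nonneg _)
  have habs : ∀ a, |φ (clamp a)| ≤ e := fun a => by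
    have h1 : φ bot ≤ φ (clamp a) := mono (le_inf le_sup_right hbt)
    have h2 : φ (clamp a) ≤ φ top := mono inf_le_right
    exact abs_le'.2 ⟨h2.trans ((le_abs_self _).trans (le_add_of_nonneg_left (abs_nonneg _))),
      (neg_le_neg h1).trans ((neg_le_abs _).trans (le_add_of_nonneg_right (abs_nonneg _)))⟩
  let ψ : L → principalIdeal e :=
    fun a => ⟨φ (clamp a), principalIdeal.mem_of_abs_le_unit (habs a)⟩
  have hψsup : ∀ a b, ψ (a ⊔ b) = ψ a ⊔ ψ b := fun a b => Subtype.ext <| by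
    change φ (clamp (a ⊔ b)) = φ (clamp a) ⊔ φ (clamp b)
    rw [← hsup]
    simp only [clamp]
    rw [sup_sup_distrib_right, inf_sup_right]
  have hψinf : ∀ a b, ψ (a ⊓ b) = ψ a ⊓ ψ b := fun a b => Subtype.ext <| by
    change φ (clamp (a ⊓ b)) = φ (clamp a) ⊓ φ (clamp b)
    rw [← hinf]
    simp only [clamp]
    rw [sup_inf_right, inf_inf_distrib_right]
  set N := ‖t.eval (delta (latticeDual L))‖
  have h := principalIdeal.abs_eval_le_of_forall_realHom he ψ t (N • principalIdeal.unit he)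
    fun ω hω hωe => by
      have hω' : ∀ x y, ω (x ⊓ y) = ω x ⊓ ω y := fun x y => by
        have := hω (-x) (-y)
        rw [← neg_inf, map_neg, map_neg, map_neg, ← neg_inf] at this
        exact neg_injective this
      have hmono : ∀ {x y}, x ≤ y → ω x ≤ ω y := fun {x y} hxy => by
        rw [← sup_eq_right, ← hω, sup_eq_right.2 hxy]
      have hmem : ∀ a, ω (ψ a) ∈ Set.Icc (-1 : ℝ) 1 := fun a => by
        rw [← hωe, ← map_neg]
        exact ⟨hmono (x := -principalIdeal.unit he) (neg_le.1 ((neg_le_abs _).trans (habs a))),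
          hmono (y := principalIdeal.unit he) ((le_abs_self _).trans (habs a))⟩
      -- As `|ψ a| ≤ e` and `ω e = 1`, the composition is a point of `𝕃*`; one-point families then
      -- bound the term there.
      let x : latticeDual L := ⟨fun a => ⟨ω (ψ a), hmem a⟩, fun a b =>
        ⟨(congrArg ω (hψsup a b)).trans (hω _ _), (congrArg ω (hψinf a b)).trans (hω' _ _)⟩⟩
      have := Ambient.abs_apply_le_norm (t.eval (delta (latticeDual L))) x
      rw [eval_delta_apply] at this
      rw [map_smul, hωe, smul_eq_mul, mul_one]
      exact this
  have hcl : (t.eval fun a => (ψ a : X)) = t.eval φ :=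
    t.eval_congr fun a ha => congrArg φ (hclamp a ha)
  rw [hcl] at h
  calc ‖t.eval φ‖ ≤ ‖N • e‖ := norm_le_norm_of_abs_le_abs (h.trans (le_abs_self _))
    _ = N * ‖e‖ := by rw [norm_smul, Real.norm_of_nonneg (norm_nonneg _)]
    _ ≤ N * (C + C) := by
      refine mul_le_mul_of_nonneg_left ((norm_add_le _ _).trans ?_) (norm_nonneg _)
      rw [norm_abs_eq_norm, norm_abs_eq_norm]
      exact add_le_add (hφ _) (hφ _)
    _ = 2 * C * N := by ring

end Bounds

end FBL

/-! ### Banach lattice homomorphisms and their kernels -/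

theorem IsBanachLatticeHom.of_map_sup {X Y : Type*} [NormedAddCommGroup X] [NormedSpace ℝ X]
    [Lattice X] [IsOrderedAddMonoid X] [NormedAddCommGroup Y] [NormedSpace ℝ Y] [Lattice Y]
    [IsOrderedAddMonoid Y] {T : X →L[ℝ] Y} (h : ∀ x y, T (x ⊔ y) = T x ⊔ T y) :
    IsBanachLatticeHom T := by
  refine ⟨h, fun x y => ?_⟩
  have := h (-x) (-y)
  rw [← neg_inf, map_neg, map_neg, map_neg, ← neg_inf] at this
  exact neg_injective this

theorem IsBanachLatticeHom.comp {X Y Z : Type*} [NormedAddCommGroup X] [NormedSpace ℝ X]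
    [Lattice X] [NormedAddCommGroup Y] [NormedSpace ℝ Y] [Lattice Y] [NormedAddCommGroup Z]
    [NormedSpace ℝ Z] [Lattice Z] {S : Y →L[ℝ] Z} {T : X →L[ℝ] Y} (hS : IsBanachLatticeHom S)
    (hT : IsBanachLatticeHom T) : IsBanachLatticeHom (S.comp T) :=
  ⟨fun x y => (congrArg S (hT.1 x y)).trans (hS.1 _ _),
    fun x y => (congrArg S (hT.2 x y)).trans (hS.2 _ _)⟩

theorem ClosedIdeal.isBanachLatticeHom_quotMap {X : Type*} [NormedAddCommGroup X]
    [NormedSpace ℝ X] [Lattice X] [BanachLattice X] (J : ClosedIdeal X) :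
    IsBanachLatticeHom J.quotMap :=
  ⟨J.mkₗ_sup, J.mkₗ_inf⟩

/-- The kernel of a Banach lattice homomorphism. -/
noncomputable def IsBanachLatticeHom.kerIdeal {X Y : Type*} [NormedAddCommGroup X]
    [NormedSpace ℝ X] [Lattice X] [BanachLattice X] [NormedAddCommGroup Y] [NormedSpace ℝ Y]
    [Lattice Y] [BanachLattice Y] {T : X →L[ℝ] Y} (hT : IsBanachLatticeHom T) : ClosedIdeal X where
  toSubmodule := LinearMap.ker T.toLinearMap
  solid' := by
    have habs : ∀ x, T |x| = |T x| := fun x => by rw [abs, hT.1, map_neg, abs]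
    intro x hx y hxy
    have hx0 : T x = 0 := hx
    have h : |T y| ≤ |T x| := by
      rw [← habs, ← habs, ← sup_eq_right, ← hT.1, sup_eq_right.2 hxy]
    have := norm_le_norm_of_abs_le_abs h
    rw [hx0, norm_zero] at this
    exact norm_le_zero_iff.1 this
  closed' := T.isClosed_ker

/-! ### Extension of maps from the generators -/

namespace FBL

variable {A : Type*} {K : Set (A → Set.Icc (-1 : ℝ) 1)}

variable (K) in
/-- The evaluation functions as elements of the Banach lattice that they generate. -/
noncomputable def generator (a : A) : generated K := ⟨delta K a, delta_mem_generated K a⟩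

theorem coe_eval_generator (t : LatticeTerm A) :
    ((t.eval (generator K) : generated K) : Ambient K) = t.eval (delta K) :=
  t.map_eval (generated K).subtype (fun _ _ => rfl) (generator K)

theorem norm_eval_generator (t : LatticeTerm A) :
    ‖t.eval (generator K)‖ = ‖t.eval (delta K)‖ := by
  rw [← coe_eval_generator]
  rfl

theorem norm_generator_le (a : A) : ‖generator K a‖ ≤ 1 :=
  Ambient.norm_le_of (f := delta K a) fun p => p.2 a

theorem isBanachLatticeHom_restrict {K' : Set (A → Set.Icc (-1 : ℝ) 1)} (h : K ⊆ K') :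
    IsBanachLatticeHom (restrict h) :=
  ⟨fun _ _ => rfl, fun _ _ => rfl⟩

/-- A property of elements of the generated Banach lattice that holds on a closed vector sublattice
containing the generators holds everywhere. -/
theorem generated_induction {M : Submodule ℝ (generated K)}
    (hclosed : IsClosed (M : Set (generated K))) (hsup : ∀ f ∈ M, ∀ g ∈ M, f ⊔ g ∈ M)
    (hgen : ∀ a, generator K a ∈ M) (f : generated K) : f ∈ M := by
  have hinf : ∀ f ∈ M, ∀ g ∈ M, f ⊓ g ∈ M := fun f hf g hg => by
    have := M.neg_mem (hsup _ (M.neg_mem hf) _ (M.neg_mem hg))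
    rwa [neg_sup, neg_neg, neg_neg] at this
  have hN : IsClosedSublattice (M.map (generated K).subtype) :=
    { closed := (isClosedSublattice_generated K).closed.isClosedEmbedding_subtypeVal.isClosedMap
        _ hclosed
      sup_mem := by
        rintro _ ⟨f, hf, rfl⟩ _ ⟨g, hg, rfl⟩
        exact ⟨f ⊔ g, hsup f hf g hg, rfl⟩
      inf_mem := by
        rintro _ ⟨f, hf, rfl⟩ _ ⟨g, hg, rfl⟩
        exact ⟨f ⊓ g, hinf f hf g hg, rfl⟩ }
  obtain ⟨g, hg, hgf⟩ := (mem_generated K).1 f.2 _ hN fun a => ⟨_, hgen a, rfl⟩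
  rwa [← Subtype.ext hgf]

variable {X : Type*} [NormedAddCommGroup X] [NormedSpace ℝ X] [Lattice X]

theorem hom_ext {S T : generated K →L[ℝ] X} (hS : IsBanachLatticeHom S)
    (hT : IsBanachLatticeHom T) (h : ∀ a, S (generator K a) = T (generator K a)) : S = T := by
  ext f
  refine generated_induction (M := LinearMap.eqLocus S.toLinearMap T.toLinearMap)
    (isClosed_eq S.continuous T.continuous) (fun f hf g hg => ?_) h f
  change S (f ⊔ g) = T (f ⊔ g)
  rw [hS.1, hT.1, show S f = T f from hf, show S g = T g from hg]

/-- The vector sublattice generated by the graph of a map defined on the generators. -/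
noncomputable def termGraph (K : Set (A → Set.Icc (-1 : ℝ) 1)) (φ : A → X) :
    Submodule ℝ (generated K × X) where
  carrier := Set.range fun t : LatticeTerm A => (t.eval (generator K), t.eval φ)
  zero_mem' := ⟨.zero, rfl⟩
  add_mem' := by
    rintro _ _ ⟨s, rfl⟩ ⟨t, rfl⟩
    exact ⟨.add s t, rfl⟩
  smul_mem' := by
    rintro c _ ⟨t, rfl⟩
    exact ⟨.smul c t, rfl⟩

/-- The closure of a vector sublattice is again one, because `⊔` is continuous, and here it contains
the generators. -/
theorem denseRange_fst_termGraph (φ : A → X) :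
    DenseRange ((LinearMap.fst ℝ (generated K) X).comp (termGraph K φ).subtype) := by
  set e := (LinearMap.fst ℝ (generated K) X).comp (termGraph K φ).subtype
  have hmem : ∀ t : LatticeTerm A, t.eval (generator K) ∈ LinearMap.range e :=
    fun t => ⟨⟨_, t, rfl⟩, rfl⟩
  have hsup : ∀ f ∈ LinearMap.range e, ∀ g ∈ LinearMap.range e, f ⊔ g ∈ LinearMap.range e := by
    rintro _ ⟨⟨_, s, rfl⟩, rfl⟩ _ ⟨⟨_, t, rfl⟩, rfl⟩
    exact hmem (.sup s t)
  intro f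
  rw [← LinearMap.coe_range, ← Submodule.topologicalClosure_coe]
  refine generated_induction (Submodule.isClosed_topologicalClosure _) (fun f hf g hg => ?_)
    (fun a => Submodule.le_topologicalClosure _ (hmem (.var a))) f
  exact map_mem_closure₂ continuous_sup hf hg hsup

/-- A map from `A` to a Banach lattice whose values on terms are controlled by the norm of the
generated Banach lattice extends to a Banach lattice homomorphism. -/
theorem exists_hom [BanachLattice X] {φ : A → X} {C : ℝ} (hC : 0 ≤ C)
    (h : ∀ t : LatticeTerm A, ‖t.eval φ‖ ≤ C * ‖t.eval (delta K)‖) :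
    ∃ T : generated K →L[ℝ] X, IsBanachLatticeHom T ∧ (∀ a, T (generator K a) = φ a) ∧
      ‖T‖ ≤ C := by
  -- Different terms may have the same value in `generated K`. The bound `‖f x‖ ≤ C * ‖e x‖` on the
  -- graph makes the value in `X` well defined and lets it extend from the dense range of `e`.
  let e := (LinearMap.fst ℝ (generated K) X).comp (termGraph K φ).subtype
  let f := (LinearMap.snd ℝ (generated K) X).comp (termGraph K φ).subtype
  have hd : DenseRange e := denseRange_fst_termGraph φ
  have hfe : ∀ x, ‖f x‖ ≤ C * ‖e x‖ := by
    rintro ⟨_, t, rfl⟩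
    exact (h t).trans_eq (by rw [← norm_eval_generator]; rfl)
  have hT : ∀ t : LatticeTerm A, f.extendOfNorm e (t.eval (generator K)) = t.eval φ := fun t =>
    LinearMap.extendOfNorm_eq hd ⟨C, hfe⟩ ⟨_, t, rfl⟩
  refine ⟨f.extendOfNorm e, .of_map_sup fun x y => ?_, fun a => hT (.var a),
    LinearMap.opNorm_extendOfNorm_le hd hC hfe⟩
  refine hd.induction_on₂ (p := fun x y => f.extendOfNorm e (x ⊔ y) =
    f.extendOfNorm e x ⊔ f.extendOfNorm e y) ?_ ?_ x y
  · exact isClosed_eq ((f.extendOfNorm e).continuous.comp continuous_sup)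
      (((f.extendOfNorm e).continuous.comp continuous_fst).sup
        ((f.extendOfNorm e).continuous.comp continuous_snd))
  · rintro ⟨_, s, rfl⟩ ⟨_, t, rfl⟩
    exact (hT (.sup s t)).trans (congrArg₂ _ (hT s) (hT t)).symm

end FBL

/-! ### The equivalence -/

open FBL

theorem corollary3p4 (𝕃 : Type u) [DistribLattice 𝕃] :
    IsInftyProjective (FreeBLLattice 𝕃) ↔
      ∃ v : FreeBLLattice 𝕃 →L[ℝ] FreeBLSet 𝕃, IsBanachLatticeHom v ∧
        (restrictionMap 𝕃).comp v = ContinuousLinearMap.id ℝ (FreeBLLattice 𝕃) := by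
  have hR : IsBanachLatticeHom (restrictionMap 𝕃) := isBanachLatticeHom_restrict _
  constructor
  · rintro ⟨lam, -, hproj⟩
    let J := hR.kerIdeal
    let φ : 𝕃 → J.Quot := fun a => J.quotMap (generator _ a)
    have hφ : ∀ a, ‖φ a‖ ≤ 1 := fun a => (J.norm_mkₗ_le _).trans (norm_generator_le a)
    -- The difference of `δ_{a ⊔ b}` and `δ_a ⊔ δ_b` vanishes on `𝕃*`, so it lies in the kernel of
    -- `R`.
    have hsup : ∀ a b, φ (a ⊔ b) = φ a ⊔ φ b := fun a b => by
      refine (J.mkₗ_eq.2 ?_).trans (J.mkₗ_sup _ _)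
      refine LinearMap.sub_mem_ker_iff.2 ?_
      exact Subtype.ext (Ambient.ext fun x => (x.2 a b).1)
    have hinf : ∀ a b, φ (a ⊓ b) = φ a ⊓ φ b := fun a b => by
      refine (J.mkₗ_eq.2 ?_).trans (J.mkₗ_inf _ _)
      refine LinearMap.sub_mem_ker_iff.2 ?_
      exact Subtype.ext (Ambient.ext fun x => (x.2 a b).2)
    obtain ⟨T, hT, hTφ, -⟩ := exists_hom (by norm_num)
      (norm_eval_le_of_latticeHom hφ hsup hinf)
    obtain ⟨S, hS, hST, -⟩ := hproj (FreeBLSet 𝕃) J T hT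
    refine ⟨S, hS, hom_ext (hR.comp hS) ⟨fun _ _ => rfl, fun _ _ => rfl⟩ fun a => ?_⟩
    have h1 : J.quotMap (S (generator _ a)) = J.quotMap (generator _ a) :=
      (congrArg (fun f => f (generator _ a)) hST).trans (hTφ a)
    exact LinearMap.sub_mem_ker_iff.1 (J.mkₗ_eq.1 h1)
  · rintro ⟨v, hv, hRv⟩
    -- The lift has norm at most `2 * ‖v‖ * ‖T‖`; the extra `2` ensures a constant above `1`.
    refine ⟨2 * ‖v‖ + 2, by linarith [norm_nonneg v], ?_⟩
    intro X _ _ _ _ J T hT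
    -- For `T ≠ 0`, the norm `‖T‖` serves as the slack in choosing representatives, whence the bound
    -- `2 * ‖T‖`.
    rcases T.opNorm_nonneg.eq_or_lt with hT0 | hpos
    · refine ⟨0, ⟨fun _ _ => (sup_idem _).symm, fun _ _ => (inf_idem _).symm⟩, ?_, ?_⟩
      · ext f
        have h := T.le_opNorm f
        rw [← hT0, zero_mul] at h
        exact (map_zero J.quotMap).trans (norm_le_zero_iff.1 h).symm
      · rw [← hT0, mul_zero]
        exact ContinuousLinearMap.opNorm_zero.le
    choose φ hφ hφn using fun a => J.exists_norm_lt (T (generator _ a)) hpos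
    have hφ2 : ∀ a, ‖φ a‖ ≤ 2 * ‖T‖ := fun a => by
      have := T.le_of_opNorm_le_of_le le_rfl (norm_generator_le (K := latticeDual 𝕃) a)
      linarith [hφn a]
    obtain ⟨S, hS, hSφ, hSn⟩ := exists_hom (by positivity)
      (norm_eval_le_of_bounded (by positivity) hφ2)
    have hST : J.quotMap.comp S = T.comp (restrictionMap 𝕃) :=
      hom_ext (J.isBanachLatticeHom_quotMap.comp hS) (hT.comp hR) fun a =>
        (congrArg J.quotMap (hSφ a)).trans (hφ a)
    refine ⟨S.comp v, hS.comp hv, ?_, ?_⟩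
    · rw [← ContinuousLinearMap.comp_assoc, hST, ContinuousLinearMap.comp_assoc, hRv,
        ContinuousLinearMap.comp_id]
    · calc ‖S.comp v‖ ≤ ‖S‖ * ‖v‖ := S.opNorm_comp_le v
        _ ≤ 2 * ‖T‖ * ‖v‖ := by gcongr
        _ ≤ (2 * ‖v‖ + 2) * ‖T‖ := by nlinarith
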